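/- **Setting.** Let $f:\mathbb R^d\to\mathbb R$ be differentiable and bounded below, with $\|\nabla f(x)-\nabla f(y)\|\le L\|x-y\|$ for all $x,y$, where $L>0$. Let $\nabla f(x;\xi)$, $\xi\sim\mathcal D$, be stochastic gradients with $\mathbb E_\xi[\nabla f(x;\xi)]=\nabla f(x)$ and $\mathbb E_\xi\|\nabla f(x;\xi)-\nabla f(x)\|^2\le\sigma^2$ for all $x$, where $\sigma^2\ge 0$. Let $\varepsilon>0$ and $R\in[0,\infty)$. An SGD method is represented by a *computation tree* $G$ with nodes $w^0,w^1,\dots$ and root $w^0\in\mathbb R^d$: for every $s\ge 0$ there are (non-random) nodes $w_{\rm base},w_{\rm grad}\in\{w^0,\dots,w^s\}$, a (non-random) step size $\gamma\ge 0$ and a sample $\zeta\sim\mathcal D$ (samples may be reused or dependent) such that $w^{s+1}=w_{\rm base}-\gamma\nabla f(w_{\rm grad};\zeta)$, and $G$ has the edge $w_{\rm base}\to w^{s+1}$. The *distance* $\mathrm{dist}(y,z)$ of two nodes is the larger of the two numbers of edges that separate $y$ and $z$ from their closest common ancestor. The *representation* $\mathrm{repr}(y)$ is the multiset of all pairs $(w_{\rm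 grad},\zeta)$ of the edges on the path from $w^0$ to $y$. A *main branch* is an infinite path $x^0=w^0\to x^1\to x^2\to\cdots$ in $G$; the step from $x^k$ to $x^{k+1}$ has the form $x^{k+1}=x^k-\gamma_k\nabla f(z^k;\xi^k)$, and $((\gamma_k,z^k,\xi^k))_{k\ge 0}$ is the *auxiliary sequence*. Put $\mathrm{dist}(y,\{x^k\})=\min_{k\ge 0}\mathrm{dist}(y,x^k)$. **Theorem (Main Theorem, improved Birch SGD).** Let $\{x^k\}$ be a main branch of a computation tree $G$, with auxiliary sequence $\{(\gamma_k,z^k,\xi^k)\}$, such that 1. for all $k\ge 0$, $\xi^k$ is independent of $\{(x^{i+1},z^{i+1},\xi^i)\}_{i=0}^{k-1}$; 2. for all $k\ge 0$, $\mathrm{repr}(z^k)\subseteq\mathrm{repr}(x^k)$ as multisets; 3. for all $k\ge 0$, $\mathrm{dist}(x^k,z^k)\le R$; 4. for all $k\ge 0$, $\gamma_k=\gamma_g:=\min\left\{\frac1{2L},\frac1{4RL},\frac{\varepsilon}{8\sigma^2L}\right\}$ (a quotient with denominator $0$ is $\infty$), and every step $y-\gamma\nabla f(\cdot\,;\cdot)$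 of $G$ that is not an edge of the main branch has step size $\gamma\le\sqrt{\frac{R}{(j+1)(\log R+1)}}\;\gamma_g$, where $j=\mathrm{dist}(y,\{x^k\})$ (the root is read as $0$ if $R=0$, and also if $\log R+1\le 0$). Let $\Delta=f(x^0)-\inf_{x\in\mathbb R^d}f(x)$. Then $\mathbb E\|\nabla f(x^k)\|^2<\infty$ for all $k\ge0$, and $$\frac1K\sum_{k=0}^{K-1}\mathbb E\left[\|\nabla f(x^k)\|^2\right]\le\varepsilon\qquad\text{for all integers }K\ge1\text{ with }K\ge\frac{8(R+1)L\Delta}{\varepsilon}+\frac{16\sigma^2L\Delta}{\varepsilon^2}.$$ -/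

import Mathlib

open MeasureTheory ProbabilityTheory

noncomputable section

namespace BirchSGD

/-- The Euclidean space `ℝ^d`. -/
abbrev Vec (d : ℕ) : Type := EuclideanSpace ℝ (Fin d)

/-- `f` is differentiable and `L`-smooth: its gradient is `L`-Lipschitz. -/
def IsSmooth {d : ℕ} (f : Vec d → ℝ) (L : ℝ) : Prop :=
  Differentiable ℝ f ∧ ∀ x y : Vec d, ‖gradient f x - gradient f y‖ ≤ L * ‖x - y‖

/-- `g x ξ` (in symbols `∇f(x; ξ)`), with `ξ` distributed as `D`, is an unbiased estimator of
`∇f(x)` whose variance is at most `σ²`, at every point `x`. -/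
structure IsStochasticGradient {d : ℕ} {S : Type*} [MeasurableSpace S] (f : Vec d → ℝ)
    (D : Measure S) (g : Vec d → S → Vec d) (σ : ℝ) : Prop where
  measurable : Measurable (fun p : Vec d × S => g p.1 p.2)
  integrable : ∀ x, Integrable (g x) D
  unbiased : ∀ x, ∫ ξ, g x ξ ∂D = gradient f x
  integrable_sq : ∀ x, Integrable (fun ξ => ‖g x ξ - gradient f x‖ ^ 2) D
  variance_le : ∀ x, ∫ ξ, ‖g x ξ - gradient f x‖ ^ 2 ∂D ≤ σ ^ 2

/-- A run of an SGD method, recorded as a computation tree. The nodes `w⁰, w¹, …` are named by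
`0, 1, …`. Step `s` creates the node `s + 1` from two earlier nodes: the point `w_base` it starts
from and the point `w_grad` at which the stochastic gradient is evaluated. The samples may be
reused, i.e. `sample s` and `sample t` may be equal or dependent. -/
structure ComputationTree (d : ℕ) {Ω S : Type*} [MeasurableSpace Ω] [MeasurableSpace S]
    (μ : Measure Ω) (D : Measure S) where
  /-- the starting point `w⁰` -/
  start : Vec d
  /-- the node from which step `s` is taken -/
  base : ℕ → ℕ
  base_le : ∀ s, base s ≤ s
  /-- the node at which the stochastic gradient of step `s` is evaluated -/
  grad : ℕ → ℕ
  grad_le : ∀ s, grad s ≤ s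
  /-- the step size of step `s` -/
  stepSize : ℕ → ℝ
  stepSize_nonneg : ∀ s, 0 ≤ stepSize s
  /-- the random sample used in step `s` -/
  sample : ℕ → Ω → S
  sample_measurable : ∀ s, Measurable (sample s)
  sample_law : ∀ s, μ.map (sample s) = D

namespace ComputationTree

variable {d : ℕ} {Ω S : Type*} [MeasurableSpace Ω] [MeasurableSpace S]
  {μ : Measure Ω} {D : Measure S}

/-- The random point at a node:
`w^{s+1} = w_base - γ ∇f(w_grad; ζ)`. -/
def point (G : ComputationTree d μ D) (g : Vec d → S → Vec d) : ℕ → Ω → Vec d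
  | 0 => fun _ => G.start
  | s + 1 => fun ω =>
      point G g (G.base s) ω - G.stepSize s • g (point G g (G.grad s) ω) (G.sample s ω)
termination_by n => n
decreasing_by
  · exact Nat.lt_succ_of_le (G.base_le s)
  · exact Nat.lt_succ_of_le (G.grad_le s)

/-- The number of edges between the root and a node. -/
def depth (G : ComputationTree d μ D) : ℕ → ℕ
  | 0 => 0
  | s + 1 => depth G (G.base s) + 1
termination_by n => n
decreasing_by exact Nat.lt_succ_of_le (G.base_le s)

/-- The ancestors of a node, the node itself included. -/
def ancestors (G : ComputationTree d μ D) : ℕ → Finset ℕ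
  | 0 => {0}
  | s + 1 => insert (s + 1) (ancestors G (G.base s))
termination_by n => n
decreasing_by exact Nat.lt_succ_of_le (G.base_le s)

/-- The depth of the closest (that is, deepest) common ancestor of two nodes. -/
def commonDepth (G : ComputationTree d μ D) (y z : ℕ) : ℕ :=
  (G.ancestors y ∩ G.ancestors z).sup G.depth

/-- The tree distance: the larger of the two numbers of edges that separate `y` and `z` from
their closest common ancestor. -/
def treeDist (G : ComputationTree d μ D) (y z : ℕ) : ℕ :=
  max (G.depth y - G.commonDepth y z) (G.depth z - G.commonDepth y z)

/-- The multiset of the pairs (point, sample) of the stochastic gradients that are applied to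
`w⁰` to get the point at a node. -/
def representation (G : ComputationTree d μ D) (g : Vec d → S → Vec d) :
    ℕ → Multiset ((Ω → Vec d) × (Ω → S))
  | 0 => 0
  | s + 1 => (G.point g (G.grad s), G.sample s) ::ₘ representation G g (G.base s)
termination_by n => n
decreasing_by exact Nat.lt_succ_of_le (G.base_le s)

/-- The sequence of nodes `b 0, b 1, …` is an infinite path that starts at the root and goes from
each node to one of its direct successors. -/
def IsMainBranch (G : ComputationTree d μ D) (b : ℕ → ℕ) : Prop :=
  b 0 = 0 ∧ ∀ k, b (k + 1) ≠ 0 ∧ G.base (b (k + 1) - 1) = b k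

/-- `γ_k`: the step size of the step that leads from `b k` to `b (k + 1)`. -/
def auxStepSize (G : ComputationTree d μ D) (b : ℕ → ℕ) (k : ℕ) : ℝ :=
  G.stepSize (b (k + 1) - 1)

/-- The node `z^k` at which the stochastic gradient of the step from `b k` to `b (k + 1)` is
evaluated. -/
def auxNode (G : ComputationTree d μ D) (b : ℕ → ℕ) (k : ℕ) : ℕ :=
  G.grad (b (k + 1) - 1)

/-- The sample `ξ^k` that is used in the step from `b k` to `b (k + 1)`. -/
def auxSample (G : ComputationTree d μ D) (b : ℕ → ℕ) (k : ℕ) : Ω → S :=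
  G.sample (b (k + 1) - 1)

/-- The distance from a node to a branch, `min_k dist(y, b k)`. -/
def distToBranch (G : ComputationTree d μ D) (b : ℕ → ℕ) (y : ℕ) : ℕ :=
  ⨅ k, G.treeDist y (b k)

end ComputationTree

/-- `γ_g = min {1/(2L), 1/(4RL), ε/(8σ²L)}`. The three quotients are taken in `[0, ∞]`, so that one
with denominator zero is `∞` and does not take part in the minimum. -/
def globalStepSize (L R σ ε : ℝ) : ℝ :=
  (min (1 / ENNReal.ofReal (2 * L))
    (min (1 / ENNReal.ofReal (4 * R * L))
      (ENNReal.ofReal ε / ENNReal.ofReal (8 * σ ^ 2 * L)))).toReal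

end BirchSGD

end

/-! The tree enters only through one expansion. The path to `z^k` leaves the main branch at some
`x^p` and then makes `m` steps off it. Cancelling the common prefix in `repr(z^k) ⊆ repr(x^k)`
matches these steps with distinct main-branch steps between `x^p` and `x^k`. Hence `z^k - x^k` is a
combination of the last `⌊R⌋` stochastic gradients with nonrandom coefficients `γ - c_i` for `i ≥ p`
and zero before, where `c_i` is the matched off-branch step size, or zero. The `j`-th off-branch
step starts at distance at least `j` from the branch, so the step-size rule and a harmonic sum give
`∑ c_i² ≤ Rγ²`, and the squared coefficients sum to at most `2Rγ²`
(`IsMainBranch.exists_coefficients`).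

What remains concerns `IsDelayedSGD`. In `z^k - x^k` the true gradients are bounded by
Cauchy-Schwarz, while the noise terms are orthogonal in `L²` and cost only order `Rγ²σ²`, not
`R²γ²σ²`. Telescoping the descent inequality gives linear relations between the summed squared
gradients at `x^k`, at `z^k`, and their differences. `le_of_descent_bounds` solves them, using that
one of the three bounds defining the step size is attained. -/

namespace BirchSGD

/-! ### Combinatorics of the computation tree -/

/-- Weights on an index set `s` can be transported along an inclusion of the multisets of labels. -/
lemma exists_weights_of_map_le {ι κ P : Type*} [DecidableEq ι] [DecidableEq κ] (q : ι → P)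
    (r : κ → P) (w : ι → ℝ) (hw : ∀ i, 0 ≤ w i) (s : Finset ι) (t : Finset κ)
    (h : s.val.map q ≤ t.val.map r) :
    ∃ c : κ → ℝ, (∀ i, 0 ≤ c i) ∧ ∑ i ∈ t, c i ^ 2 = ∑ j ∈ s, w j ^ 2 ∧
      ∀ {E : Type} [AddCommGroup E] [Module ℝ E] (φ : P → E),
        ∑ i ∈ t, c i • φ (r i) = ∑ j ∈ s, w j • φ (q j) := by
  induction s using Finset.induction_on generalizing t with
  | empty => exact ⟨0, by simp, by simp, by simp⟩
  | insert a s ha ih =>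
    rw [Finset.insert_val_of_notMem ha, Multiset.map_cons] at h
    have hmem : q a ∈ t.val.map r := Multiset.mem_of_le h (Multiset.mem_cons_self _ _)
    obtain ⟨i, hi, hia⟩ := Multiset.mem_map.1 hmem
    have ht : t = insert i (t.erase i) := (Finset.insert_erase hi).symm
    have hni : i ∉ t.erase i := Finset.notMem_erase i t
    have h' : s.val.map q ≤ (t.erase i).val.map r := by
      rw [ht, Finset.insert_val_of_notMem hni, Multiset.map_cons, hia] at h
      exact (Multiset.cons_le_cons_iff _).1 h
    obtain ⟨c, hc, hsq, hlin⟩ := ih _ h'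
    have hne : ∀ j ∈ t.erase i, j ≠ i := fun j hj => Finset.ne_of_mem_erase hj
    -- Greedy matching: `a` takes one `i` with its label, and `i` leaves `t`, so no index serves
    -- twice.
    refine ⟨Function.update c i (w a), fun j => ?_, ?_, fun φ => ?_⟩
    · by_cases hj : j = i
      · subst hj; simpa using hw a
      · simpa [hj] using hc j
    · rw [ht, Finset.sum_insert hni, Finset.sum_insert ha, ← hsq]
      congr 1
      · simp
      · exact Finset.sum_congr rfl fun j hj => by rw [Function.update_of_ne (hne j hj)]
    · rw [ht, Finset.sum_insert hni, Finset.sum_insert ha, ← hlin]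
      congr 1
      · simp [hia]
      · exact Finset.sum_congr rfl fun j hj => by rw [Function.update_of_ne (hne j hj)]

namespace ComputationTree

variable {d : ℕ} {Ω S : Type*} [MeasurableSpace Ω] [MeasurableSpace S]
  {μ : Measure Ω} {D : Measure S}

lemma point_succ (G : ComputationTree d μ D) (g : Vec d → S → Vec d) (s : ℕ) (ω : Ω) :
    G.point g (s + 1) ω = G.point g (G.base s) ω
      - G.stepSize s • g (G.point g (G.grad s) ω) (G.sample s ω) := by
  rw [point]

lemma card_representation (G : ComputationTree d μ D) (g : Vec d → S → Vec d) (n : ℕ) :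
    Multiset.card (G.representation g n) = G.depth n := by
  induction n using Nat.strong_induction_on with
  | _ n ih =>
    cases n with
    | zero => simp [representation, depth]
    | succ s => rw [representation, depth, Multiset.card_cons, ih _ (Nat.lt_succ_of_le (G.base_le s))]

lemma measurable_point (G : ComputationTree d μ D) {g : Vec d → S → Vec d}
    (hg : Measurable fun p : Vec d × S => g p.1 p.2) (n : ℕ) : Measurable (G.point g n) := by
  induction n using Nat.strong_induction_on with
  | _ n ih =>
    cases n with
    | zero => rw [point]; exact measurable_const
    | succ s =>
      rw [point]
      exact (ih _ (Nat.lt_succ_of_le (G.base_le s))).sub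
        ((hg.comp ((ih _ (Nat.lt_succ_of_le (G.grad_le s))).prodMk
          (G.sample_measurable s))).const_smul (G.stepSize s))

variable {G : ComputationTree d μ D} {b : ℕ → ℕ}

lemma IsMainBranch.succ_pred (hb : G.IsMainBranch b) (k : ℕ) : b (k + 1) - 1 + 1 = b (k + 1) :=
  Nat.succ_pred_eq_of_ne_zero (hb.2 k).1

lemma IsMainBranch.depth (hb : G.IsMainBranch b) (k : ℕ) : G.depth (b k) = k := by
  induction k with
  | zero => rw [hb.1, ComputationTree.depth]
  | succ k ih => rw [← hb.succ_pred, ComputationTree.depth, (hb.2 k).2, ih]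

lemma IsMainBranch.injective (hb : G.IsMainBranch b) : Function.Injective b :=
  fun i j h => by rw [← hb.depth i, h, hb.depth]

lemma IsMainBranch.ancestors (hb : G.IsMainBranch b) (k : ℕ) :
    G.ancestors (b k) = (Finset.range (k + 1)).image b := by
  induction k with
  | zero => simp [hb.1, ComputationTree.ancestors]
  | succ k ih =>
    rw [← hb.succ_pred, ComputationTree.ancestors, (hb.2 k).2, ih, hb.succ_pred,
      ← Finset.image_insert, Finset.range_add_one (n := k + 1)]

lemma IsMainBranch.point_succ (hb : G.IsMainBranch b) (g : Vec d → S → Vec d) (k : ℕ) (ω : Ω) :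
    G.point g (b (k + 1)) ω = G.point g (b k) ω
      - G.auxStepSize b k • g (G.point g (G.auxNode b k) ω) (G.auxSample b k ω) := by
  rw [← hb.succ_pred, ComputationTree.point_succ, (hb.2 k).2]; rfl

lemma IsMainBranch.point_eq (hb : G.IsMainBranch b) (g : Vec d → S → Vec d) {p k : ℕ}
    (hpk : p ≤ k) (ω : Ω) :
    G.point g (b k) ω = G.point g (b p) ω - ∑ i ∈ Finset.Ico p k,
      G.auxStepSize b i • g (G.point g (G.auxNode b i) ω) (G.auxSample b i ω) := by
  induction k, hpk using Nat.le_induction with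
  | base => simp
  | succ k hk ih => rw [hb.point_succ, ih, Finset.sum_Ico_succ_top hk]; abel

lemma IsMainBranch.representation_eq (hb : G.IsMainBranch b) (g : Vec d → S → Vec d) {p k : ℕ}
    (hpk : p ≤ k) :
    G.representation g (b k) = G.representation g (b p) + (Finset.Ico p k).val.map
      fun i => (G.point g (G.auxNode b i), G.auxSample b i) := by
  induction k, hpk using Nat.le_induction with
  | base => simp
  | succ k hk ih =>
    rw [← hb.succ_pred, representation, (hb.2 k).2, ih, ← Finset.insert_Ico_right_eq_Ico_add_one hk,
      Finset.insert_val_of_notMem (by simp), Multiset.map_cons, Multiset.add_cons]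
    rfl

/-- The closest common ancestor of `n` and a node of the main branch is not deeper than the last
main branch node above `n`. -/
lemma IsMainBranch.commonDepth_le (hb : G.IsMainBranch b) {n p : ℕ}
    (h : ∀ i, b i ∈ G.ancestors n → i ≤ p) (k : ℕ) :
    G.commonDepth n (b k) ≤ p ∧ G.commonDepth (b k) n ≤ p := by
  have key : ∀ a ∈ G.ancestors n, a ∈ G.ancestors (b k) → G.depth a ≤ p := by
    intro a ha ha'
    rw [hb.ancestors, Finset.mem_image] at ha'
    obtain ⟨i, -, rfl⟩ := ha'
    rw [hb.depth]; exact h i ha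
  constructor <;> refine Finset.sup_le fun a ha => ?_ <;> rw [Finset.mem_inter] at ha
  · exact key a ha.1 ha.2
  · exact key a ha.2 ha.1

/-- Every node is reached from a node of the main branch by steps off the main branch. -/
lemma IsMainBranch.exists_off_path (hb : G.IsMainBranch b) (g : Vec d → S → Vec d) (n : ℕ) :
    ∃ (p m : ℕ) (e : ℕ → ℕ), G.depth n = p + m ∧
      G.representation g n = G.representation g (b p) + (Finset.range m).val.map
        (fun j => (G.point g (G.grad (e j)), G.sample (e j))) ∧
      (∀ ω, G.point g n ω = G.point g (b p) ω - ∑ j ∈ Finset.range m,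
        G.stepSize (e j) • g (G.point g (G.grad (e j)) ω) (G.sample (e j) ω)) ∧
      (∀ j < m, (∀ k, b (k + 1) ≠ e j + 1) ∧ j ≤ G.distToBranch b (G.base (e j))) ∧
      ∀ i, b i ∈ G.ancestors n → i ≤ p := by
  induction n using Nat.strong_induction_on with
  | _ n ih =>
    by_cases hn : ∃ k, b k = n
    · obtain ⟨k, rfl⟩ := hn
      refine ⟨k, 0, id, by simp [hb.depth], by simp, by simp, by simp, fun i hi => ?_⟩
      rw [hb.ancestors, Finset.mem_image] at hi
      obtain ⟨l, hl, hli⟩ := hi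
      rw [← hb.injective hli]
      exact Nat.lt_succ_iff.1 (Finset.mem_range.1 hl)
    · push Not at hn
      cases n with
      | zero => exact absurd hb.1 (hn 0)
      | succ s =>
        obtain ⟨p, m, e, hdep, hrep, hpt, hoff, hanc⟩ := ih _ (Nat.lt_succ_of_le (G.base_le s))
        have hlt : ∀ j ∈ Finset.range m, Function.update e m s j = e j := fun j hj =>
          Function.update_of_ne (Finset.mem_range.1 hj).ne _ _
        refine ⟨p, m + 1, Function.update e m s, ?_, ?_, fun ω => ?_, fun j hj => ?_,
          fun i hi => ?_⟩
        · rw [ComputationTree.depth, hdep, add_assoc]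
        · rw [representation, hrep, Finset.range_add_one,
            Finset.insert_val_of_notMem (by simp), Multiset.map_cons, Multiset.add_cons]
          congr 1
          · simp
          · congr 1
            exact Multiset.map_congr rfl fun j hj => by rw [hlt j hj]
        · rw [ComputationTree.point_succ, hpt, Finset.sum_range_succ, Function.update_self, sub_sub]
          congr 2
          exact Finset.sum_congr rfl fun j hj => by rw [hlt j hj]
        · rcases Nat.lt_succ_iff_lt_or_eq.1 hj with hj | rfl
          · rw [hlt j (Finset.mem_range.2 hj)]; exact hoff j hj
          · rw [Function.update_self]
            refine ⟨fun k => hn _, le_ciInf fun k => ?_⟩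
            -- The base lies one level below `x^p` per earlier off-branch step, and shares with the
            -- branch no ancestor deeper than `x^p`.
            have := (hb.commonDepth_le hanc k).1
            rw [treeDist]
            omega
        · rw [ComputationTree.ancestors, Finset.mem_insert] at hi
          exact hanc i (hi.resolve_left (hn i))

/-- The factor `log R + 1` in the step-size rule absorbs the harmonic sum. A nonempty sum forces `R
≥ 1`, so the default values of the root and the quotient play no role. -/
lemma sum_sq_sqrt_div_le {R γ : ℝ} (hR : 0 ≤ R) {m : ℕ} (hm : (m : ℝ) ≤ R) :
    ∑ j ∈ Finset.range m, (√(R / (((j : ℝ) + 1) * (Real.log R + 1))) * γ) ^ 2 ≤ R * γ ^ 2 := by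
  rcases Nat.eq_zero_or_pos m with rfl | hpos
  · simpa using by positivity
  have hm1 : (1 : ℝ) ≤ m := by exact_mod_cast hpos
  have hlog : 0 ≤ Real.log R := Real.log_nonneg (hm1.trans hm)
  have hsum : ∑ j ∈ Finset.range m, ((j : ℝ) + 1)⁻¹ ≤ Real.log R + 1 := by
    have h1 := harmonic_le_one_add_log m
    have h2 : Real.log m ≤ Real.log R := Real.log_le_log (by linarith) hm
    have h3 : ((harmonic m : ℚ) : ℝ) = ∑ j ∈ Finset.range m, ((j : ℝ) + 1)⁻¹ := by
      simp [harmonic]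
    linarith
  have hterm : ∀ j ∈ Finset.range m, (√(R / (((j : ℝ) + 1) * (Real.log R + 1))) * γ) ^ 2
      = R * γ ^ 2 / (Real.log R + 1) * ((j : ℝ) + 1)⁻¹ := by
    intro j _
    rw [mul_pow, Real.sq_sqrt (by positivity)]
    field_simp
  rw [Finset.sum_congr rfl hterm, ← Finset.mul_sum]
  calc _ ≤ R * γ ^ 2 / (Real.log R + 1) * (Real.log R + 1) := by gcongr
    _ = R * γ ^ 2 := by field_simp

/-- The point `z^k` differs from `x^k` by a combination of the last stochastic gradients, with a
bound on the squares of the coefficients. -/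
lemma IsMainBranch.exists_coefficients (hb : G.IsMainBranch b) (g : Vec d → S → Vec d) {R γ : ℝ}
    (hR : 0 ≤ R) (hγ : 0 ≤ γ) {k : ℕ}
    (h_repr : G.representation g (G.auxNode b k) ≤ G.representation g (b k))
    (h_dist : (G.treeDist (b k) (G.auxNode b k) : ℝ) ≤ R)
    (h_main : ∀ k : ℕ, G.auxStepSize b k = γ)
    (h_off : ∀ s : ℕ, (∀ k : ℕ, b (k + 1) ≠ s + 1) →
      G.stepSize s ≤
        √(R / (((G.distToBranch b (G.base s) : ℝ) + 1) * (Real.log R + 1))) * γ) :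
    ∃ a : ℕ → ℝ, (∀ ω, G.point g (G.auxNode b k) ω = G.point g (b k) ω +
        ∑ i ∈ Finset.Ico (k - ⌊R⌋₊) k,
          a i • g (G.point g (G.auxNode b i) ω) (G.auxSample b i ω)) ∧
      ∑ i ∈ Finset.Ico (k - ⌊R⌋₊) k, a i ^ 2 ≤ 2 * R * γ ^ 2 := by
  classical
  obtain ⟨p, m, e, hdep, hrep, hpt, hoff, hanc⟩ := hb.exists_off_path g (G.auxNode b k)
  have hcard := Multiset.card_le_card h_repr
  rw [card_representation, card_representation, hdep, hb.depth] at hcard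
  have hpk : p ≤ k := by omega
  -- The closest common ancestor has depth at most `p`, while the two nodes have depths `k` and `p +
  -- m`.
  have hdist : max (k - p) m ≤ ⌊R⌋₊ := by
    refine le_trans ?_ (Nat.le_floor h_dist)
    have h1 := (hb.commonDepth_le hanc k).2
    have h2 := hb.depth k
    rw [treeDist]
    omega
  have hmR : (m : ℝ) ≤ R := (Nat.le_floor_iff hR).1 (le_trans (le_max_right _ _) hdist)
  have hkR : ((k - p : ℕ) : ℝ) ≤ R := (Nat.le_floor_iff hR).1 (le_trans (le_max_left _ _) hdist)
  rw [hrep, hb.representation_eq g hpk] at h_repr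
  obtain ⟨c, hc, hsq, hlin⟩ := exists_weights_of_map_le _ _ (fun j => G.stepSize (e j))
    (fun j => G.stepSize_nonneg _) _ _ (le_of_add_le_add_left h_repr)
  have hcsq : ∑ i ∈ Finset.Ico p k, c i ^ 2 ≤ R * γ ^ 2 := by
    rw [hsq]
    refine le_trans (Finset.sum_le_sum fun j hj => ?_) (sum_sq_sqrt_div_le hR hmR)
    have hjm := Finset.mem_range.1 hj
    have hR1 : 1 ≤ R := le_trans (by exact_mod_cast (by omega : 1 ≤ m)) hmR
    have hlog : 0 ≤ Real.log R := Real.log_nonneg hR1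
    obtain ⟨ho, hd⟩ := hoff j hjm
    have hs := h_off (e j) ho
    have hd' : (j : ℝ) ≤ G.distToBranch b (G.base (e j)) := by exact_mod_cast hd
    refine pow_le_pow_left₀ (G.stepSize_nonneg _) (hs.trans ?_) 2
    gcongr
  have hsub : Finset.Ico p k ⊆ Finset.Ico (k - ⌊R⌋₊) k :=
    Finset.Ico_subset_Ico_left (by have := le_trans (le_max_left _ _) hdist; omega)
  -- Starting from `x^p`, the path to `x^k` subtracts the gradient `i` with weight `γ`, the path to
  -- `z^k` with weight `c i`.
  refine ⟨fun i => if p ≤ i then γ - c i else 0, fun ω => ?_, ?_⟩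
  · rw [← Finset.sum_subset hsub]
    -- `c` was fixed before `φ`, so the same nonrandom weights serve every `ω`.
    · rw [hpt, ← hlin (fun q => g (q.1 ω) (q.2 ω)), hb.point_eq g hpk, sub_add,
        ← Finset.sum_sub_distrib]
      congr 1
      refine Finset.sum_congr rfl fun i hi => ?_
      dsimp only
      rw [if_pos (Finset.mem_Ico.1 hi).1, h_main, sub_smul]
      abel
    · intro i hi hi'
      dsimp only
      rw [if_neg, zero_smul]
      simp only [Finset.mem_Ico] at hi hi'
      omega
  · rw [← Finset.sum_subset hsub]
    · calc _ ≤ ∑ i ∈ Finset.Ico p k, (γ ^ 2 + c i ^ 2) := by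
            refine Finset.sum_le_sum fun i hi => ?_
            dsimp only
            rw [if_pos (Finset.mem_Ico.1 hi).1]
            -- Both weights are nonnegative, so the cross term `-2γ c i` can be dropped.
            nlinarith [mul_nonneg hγ (hc i)]
        _ = ((k - p : ℕ) : ℝ) * γ ^ 2 + ∑ i ∈ Finset.Ico p k, c i ^ 2 := by
            rw [Finset.sum_add_distrib]; simp
        _ ≤ R * γ ^ 2 + R * γ ^ 2 := by gcongr
        _ = 2 * R * γ ^ 2 := by ring
    · intro i hi hi'
      dsimp only
      rw [if_neg]
      · simp
      · simp only [Finset.mem_Ico] at hi hi'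
        omega

end ComputationTree

/-! ### Smooth functions -/

section Smooth

variable {d : ℕ} {f : Vec d → ℝ} {L : ℝ}

lemma IsSmooth.lipschitzWith (hf : IsSmooth f L) (hL : 0 ≤ L) :
    LipschitzWith ⟨L, hL⟩ (gradient f) :=
  LipschitzWith.of_dist_le_mul fun x y => by
    rw [dist_eq_norm, dist_eq_norm]; exact hf.2 x y

/-- The quadratic upper bound for functions with a Lipschitz gradient. -/
lemma IsSmooth.le_add_inner_add (hf : IsSmooth f L) (x v : Vec d) :
    f (x + v) ≤ f x + inner ℝ (gradient f x) v + L / 2 * ‖v‖ ^ 2 := by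
  -- Along the segment, `f` minus the claimed quadratic bound is antitone, by the Lipschitz
  -- condition on the gradient.
  have hd : ∀ t : ℝ, HasDerivAt
      (fun t : ℝ => f (x + t • v) - t * inner ℝ (gradient f x) v - t ^ 2 * (L / 2 * ‖v‖ ^ 2))
      (inner ℝ (gradient f (x + t • v)) v - inner ℝ (gradient f x) v
        - 2 * t * (L / 2 * ‖v‖ ^ 2)) t := by
    intro t
    have h1 : HasDerivAt (fun t : ℝ => x + t • v) v t := by
      simpa using ((hasDerivAt_id t).smul_const v).const_add x
    have h2 := (hf.1 (x + t • v)).hasGradientAt.hasFDerivAt.comp_hasDerivAt t h1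
    have h3 := (h2.sub ((hasDerivAt_id t).mul_const (inner ℝ (gradient f x) v))).sub
      ((hasDerivAt_pow 2 t).mul_const (L / 2 * ‖v‖ ^ 2))
    refine h3.congr_deriv ?_
    simp
  have hanti := antitoneOn_of_deriv_nonpos (convex_Icc (0 : ℝ) 1)
    (fun t _ => (hd t).continuousAt.continuousWithinAt)
    (fun t _ => (hd t).differentiableAt.differentiableWithinAt) (fun t ht => by
      rw [interior_Icc] at ht
      rw [(hd t).deriv, ← inner_sub_left]
      have h1 := real_inner_le_norm (gradient f (x + t • v) - gradient f x) v
      have h2 := hf.2 (x + t • v) x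
      rw [add_sub_cancel_left, norm_smul, Real.norm_of_nonneg ht.1.le] at h2
      have h3 := mul_le_mul_of_nonneg_right h2 (norm_nonneg v)
      nlinarith)
  have h := hanti (Set.left_mem_Icc.2 zero_le_one) (Set.right_mem_Icc.2 zero_le_one) zero_le_one
  simp only [one_smul, zero_smul, add_zero] at h
  linarith

end Smooth

/-! ### Square-integrable random points -/

section Integrability

variable {d : ℕ} {Ω : Type*} [MeasurableSpace Ω] {μ : Measure Ω}

lemma integrable_inner_of_memLp {u v : Ω → Vec d} (hu : MemLp u 2 μ) (hv : MemLp v 2 μ) :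
    Integrable (fun ω => inner ℝ (u ω) (v ω)) μ := by
  refine (hu.integrable_norm_pow two_ne_zero).add (hv.integrable_norm_pow two_ne_zero) |>.mono'
    (hu.1.inner hv.1) (.of_forall fun ω => ?_)
  have := abs_real_inner_le_norm (u ω) (v ω)
  simp only [Pi.add_apply, Real.norm_eq_abs]
  nlinarith [sq_nonneg (‖u ω‖ - ‖v ω‖), sq_nonneg (‖u ω‖), sq_nonneg (‖v ω‖)]

variable [IsProbabilityMeasure μ] {f : Vec d → ℝ} {L : ℝ}

lemma IsSmooth.memLp_gradient (hf : IsSmooth f L) (hL : 0 ≤ L) {x : Ω → Vec d}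
    (hx : MemLp x 2 μ) : MemLp (fun ω => gradient f (x ω)) 2 μ := by
  refine ((memLp_const ‖gradient f 0‖).add (hx.norm.const_mul L)).of_le
    ((hf.lipschitzWith hL).continuous.comp_aestronglyMeasurable hx.1) (.of_forall fun ω => ?_)
  have h1 := hf.2 (x ω) 0
  rw [sub_zero] at h1
  have h2 := norm_le_norm_add_norm_sub' (gradient f (x ω)) (gradient f 0)
  refine le_trans ?_ (le_abs_self _)
  simp only [Pi.add_apply]
  linarith

/-- `f` lies between a constant and the quadratic upper bound expanded at `0`. -/
lemma IsSmooth.integrable_comp (hf : IsSmooth f L) (hf_bdd : BddBelow (Set.range f))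
    {x : Ω → Vec d} (hx : MemLp x 2 μ) : Integrable (fun ω => f (x ω)) μ := by
  obtain ⟨m, hm⟩ := hf_bdd
  have hm' : ∀ y, m ≤ f y := fun y => hm ⟨y, rfl⟩
  have hbound : Integrable (fun ω => |m| + |f 0| + |inner ℝ (gradient f 0) (x ω)|
      + |L / 2| * ‖x ω‖ ^ 2) μ :=
    ((integrable_const _).add
      (integrable_inner_of_memLp (memLp_const (gradient f 0)) hx).abs).add
      ((hx.integrable_norm_pow two_ne_zero).const_mul _)
  refine hbound.mono' (hf.1.continuous.comp_aestronglyMeasurable hx.1) (.of_forall fun ω => ?_)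
  have h1 := hf.le_add_inner_add 0 (x ω)
  rw [zero_add] at h1
  have h2 := hm' (x ω)
  have h3 := neg_abs_le m
  have h4 := le_abs_self (f 0)
  have h5 := le_abs_self (inner ℝ (gradient f 0) (x ω))
  have h6 : L / 2 * ‖x ω‖ ^ 2 ≤ |L / 2| * ‖x ω‖ ^ 2 := by gcongr; exact le_abs_self _
  have h7 : 0 ≤ |L / 2| * ‖x ω‖ ^ 2 := by positivity
  rw [Real.norm_eq_abs, abs_le]
  constructor
  · linarith [abs_nonneg (f 0), abs_nonneg (inner ℝ (gradient f 0) (x ω))]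
  · linarith [abs_nonneg m]

end Integrability

/-! ### Noise of a fresh sample -/

section Noise

variable {d : ℕ} {Ω S : Type*} [MeasurableSpace Ω] [MeasurableSpace S]
  {μ : Measure Ω} {D : Measure S} {f : Vec d → ℝ} {g : Vec d → S → Vec d} {L σ : ℝ}
  {ξ : Ω → S} {z v : Ω → Vec d}

lemma IsStochasticGradient.measurable_noise (hg : IsStochasticGradient f D g σ)
    (hf : IsSmooth f L) (hL : 0 ≤ L) :
    Measurable fun p : Vec d × S => g p.1 p.2 - gradient f p.1 :=
  hg.measurable.sub ((hf.lipschitzWith hL).continuous.measurable.comp measurable_fst)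

variable [IsProbabilityMeasure μ] [IsProbabilityMeasure D]

/-- Independence makes the joint law a product, so Fubini reduces the claim to the variance bound at
each fixed point. -/
lemma IsStochasticGradient.integrable_noise_sq (hg : IsStochasticGradient f D g σ)
    (hf : IsSmooth f L) (hL : 0 ≤ L) (hz : Measurable z) (hξ : Measurable ξ)
    (hlaw : μ.map ξ = D) (hind : IndepFun z ξ μ) :
    Integrable (fun ω => ‖g (z ω) (ξ ω) - gradient f (z ω)‖ ^ 2) μ ∧
      ∫ ω, ‖g (z ω) (ξ ω) - gradient f (z ω)‖ ^ 2 ∂μ ≤ σ ^ 2 := by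
  have hmap := (indepFun_iff_map_prod_eq_prod_map_map hz.aemeasurable hξ.aemeasurable).1 hind
  rw [hlaw] at hmap
  have : IsProbabilityMeasure (μ.map z) := Measure.isProbabilityMeasure_map hz.aemeasurable
  set F : Vec d × S → ℝ := fun p => ‖g p.1 p.2 - gradient f p.1‖ ^ 2
  have hF : Measurable F := (hg.measurable_noise hf hL).norm.pow_const 2
  have hFint : Integrable F ((μ.map z).prod D) := by
    rw [integrable_prod_iff hF.aestronglyMeasurable]
    refine ⟨.of_forall hg.integrable_sq, ?_⟩
    refine (integrable_const (σ ^ 2)).mono'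
      (hF.aestronglyMeasurable.norm.integral_prod_right') (.of_forall fun x => ?_)
    rw [Real.norm_of_nonneg (integral_nonneg fun _ => norm_nonneg _)]
    simpa [F] using hg.variance_le x
  have hpair : AEMeasurable (fun ω => (z ω, ξ ω)) μ := (hz.prodMk hξ).aemeasurable
  constructor
  · rw [← hmap] at hFint
    exact hFint.comp_aemeasurable hpair
  · calc ∫ ω, F (z ω, ξ ω) ∂μ = ∫ p, F p ∂((μ.map z).prod D) := by
          rw [← hmap, integral_map hpair hF.aestronglyMeasurable]
      _ = ∫ x, ∫ s, F (x, s) ∂D ∂(μ.map z) := integral_prod _ hFint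
      _ ≤ ∫ _, σ ^ 2 ∂(μ.map z) :=
          integral_mono hFint.integral_prod_left (integrable_const _) hg.variance_le
      _ = σ ^ 2 := by simp

/-- By Fubini, the sample can be integrated first with `z` and `v` frozen, and unbiasedness kills
the inner integral. -/
lemma IsStochasticGradient.integral_inner_noise (hg : IsStochasticGradient f D g σ)
    (hf : IsSmooth f L) (hL : 0 ≤ L) (hz : Measurable z) (hv : Measurable v) (hξ : Measurable ξ)
    (hlaw : μ.map ξ = D) (hind : IndepFun (fun ω => (z ω, v ω)) ξ μ)
    (hint : Integrable (fun ω => inner ℝ (v ω) (g (z ω) (ξ ω) - gradient f (z ω))) μ) :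
    ∫ ω, inner ℝ (v ω) (g (z ω) (ξ ω) - gradient f (z ω)) ∂μ = 0 := by
  have hmap := (indepFun_iff_map_prod_eq_prod_map_map (hz.prodMk hv).aemeasurable
    hξ.aemeasurable).1 hind
  rw [hlaw] at hmap
  set W : Ω → Vec d × Vec d := fun ω => (z ω, v ω)
  have hW : Measurable W := hz.prodMk hv
  have : IsProbabilityMeasure (μ.map W) := Measure.isProbabilityMeasure_map hW.aemeasurable
  set F : (Vec d × Vec d) × S → ℝ := fun p => inner ℝ p.1.2 (g p.1.1 p.2 - gradient f p.1.1)
  have hF : Measurable F := (measurable_snd.comp measurable_fst).inner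
    ((hg.measurable_noise hf hL).comp ((measurable_fst.comp measurable_fst).prodMk measurable_snd))
  have hpair : AEMeasurable (fun ω => (W ω, ξ ω)) μ := (hW.prodMk hξ).aemeasurable
  have hFint : Integrable F ((μ.map W).prod D) := by
    rw [← hmap, integrable_map_measure hF.aestronglyMeasurable hpair]
    exact hint
  calc ∫ ω, F (W ω, ξ ω) ∂μ = ∫ p, F p ∂((μ.map W).prod D) := by
        rw [← hmap, integral_map hpair hF.aestronglyMeasurable]
    _ = ∫ x, ∫ s, F (x, s) ∂D ∂(μ.map W) := integral_prod _ hFint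
    _ = ∫ _, (0 : ℝ) ∂(μ.map W) := by
        congr 1
        ext x
        simp only [F]
        have hi : Integrable (fun s => g x.1 s - gradient f x.1) D :=
          (hg.integrable x.1).sub (integrable_const _)
        rw [integral_inner hi, integral_sub (hg.integrable x.1) (integrable_const _), hg.unbiased]
        simp
    _ = 0 := by simp

end Noise

/-! ### SGD with delayed gradients -/

/-- SGD iterates `x k`, whose stochastic gradients are evaluated at points `z k` that differ from
`x k` by a combination of the last `N` stochastic gradients with coefficients `a k i`. -/
structure IsDelayedSGD {d : ℕ} {Ω S : Type*} [MeasurableSpace Ω] [MeasurableSpace S]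
    (μ : Measure Ω) (D : Measure S) (g : Vec d → S → Vec d) (γ : ℝ) (N : ℕ) (a : ℕ → ℕ → ℝ)
    (x z : ℕ → Ω → Vec d) (ξ : ℕ → Ω → S) : Prop where
  start : ∃ x₀, x 0 = fun _ => x₀
  step : ∀ k ω, x (k + 1) ω = x k ω - γ • g (z k ω) (ξ k ω)
  aux : ∀ k ω, z k ω = x k ω + ∑ i ∈ Finset.Ico (k - N) k, a k i • g (z i ω) (ξ i ω)
  measurable_sample : ∀ k, Measurable (ξ k)
  sample_law : ∀ k, μ.map (ξ k) = D
  measurable_x : ∀ k, Measurable (x k)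
  measurable_z : ∀ k, Measurable (z k)
  indep : ∀ k : ℕ, IndepFun (ξ k) (fun ω (i : Fin k) => (x (i + 1) ω, z (i + 1) ω, ξ i ω)) μ

/-- The information available before sample `k` is drawn. -/
abbrev history {d : ℕ} {Ω S : Type*} [MeasurableSpace S] (x z : ℕ → Ω → Vec d) (ξ : ℕ → Ω → S)
    (k : ℕ) : MeasurableSpace Ω :=
  MeasurableSpace.comap (fun ω (i : Fin k) => (x (i + 1) ω, z (i + 1) ω, ξ i ω)) inferInstance

namespace IsDelayedSGD

variable {d : ℕ} {Ω S : Type*} [MeasurableSpace Ω] [MeasurableSpace S]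
  {μ : Measure Ω} {D : Measure S} {g : Vec d → S → Vec d} {γ : ℝ} {N : ℕ} {a : ℕ → ℕ → ℝ}
  {x z : ℕ → Ω → Vec d} {ξ : ℕ → Ω → S}

lemma measurable_history (h : IsDelayedSGD μ D g γ N a x z ξ) {i k : ℕ} :
    (i ≤ k → Measurable[history x z ξ k] (x i)) ∧ (i ≤ k → Measurable[history x z ξ k] (z i)) ∧
      (i < k → Measurable[history x z ξ k] (ξ i)) := by
  have hall : ∀ j : Fin k, Measurable[history x z ξ k]
      fun ω => (x (j + 1) ω, z (j + 1) ω, ξ j ω) := fun j =>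
    (measurable_pi_apply j).comp
      (comap_measurable fun ω (i : Fin k) => (x (i + 1) ω, z (i + 1) ω, ξ i ω))
  obtain ⟨x₀, hx₀⟩ := h.start
  -- The history records `x` and `z` only from index `1` on; at index `0` both are constant, the
  -- window being empty.
  have hz₀ : z 0 = fun _ => x₀ := by
    ext1 ω; rw [h.aux, hx₀]; simp
  refine ⟨fun hi => ?_, fun hi => ?_, fun hi => ?_⟩
  · cases i with
    | zero => rw [hx₀]; exact @measurable_const _ _ _ (history x z ξ k) _
    | succ i => exact measurable_fst.comp (hall ⟨i, hi⟩)
  · cases i with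
    | zero => rw [hz₀]; exact @measurable_const _ _ _ (history x z ξ k) _
    | succ i => exact (measurable_fst.comp measurable_snd).comp (hall ⟨i, hi⟩)
  · exact (measurable_snd.comp measurable_snd).comp (hall ⟨i, hi⟩)

lemma indepFun (h : IsDelayedSGD μ D g γ N a x z ξ) {k : ℕ} {α : Type*} [MeasurableSpace α]
    {W : Ω → α} (hW : Measurable[history x z ξ k] W) : IndepFun W (ξ k) μ := by
  have h1 := h.indep k
  rw [IndepFun_iff_Indep] at h1 ⊢
  exact (indep_of_indep_of_le_right h1 (measurable_iff_comap_le.1 hW)).symm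

variable [IsProbabilityMeasure μ] [IsProbabilityMeasure D] {f : Vec d → ℝ} {L σ : ℝ}

lemma memLp_noise (h : IsDelayedSGD μ D g γ N a x z ξ) (hf : IsSmooth f L) (hL : 0 ≤ L)
    (hg : IsStochasticGradient f D g σ) (k : ℕ) :
    MemLp (fun ω => g (z k ω) (ξ k ω) - gradient f (z k ω)) 2 μ := by
  rw [memLp_two_iff_integrable_sq_norm]
  · exact (hg.integrable_noise_sq hf hL (h.measurable_z k) (h.measurable_sample k)
      (h.sample_law k) (h.indepFun (h.measurable_history.2.1 le_rfl))).1
  · exact ((hg.measurable_noise hf hL).comp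
      ((h.measurable_z k).prodMk (h.measurable_sample k))).aestronglyMeasurable

lemma integral_noise_sq_le (h : IsDelayedSGD μ D g γ N a x z ξ) (hf : IsSmooth f L) (hL : 0 ≤ L)
    (hg : IsStochasticGradient f D g σ) (k : ℕ) :
    ∫ ω, ‖g (z k ω) (ξ k ω) - gradient f (z k ω)‖ ^ 2 ∂μ ≤ σ ^ 2 :=
  (hg.integrable_noise_sq hf hL (h.measurable_z k) (h.measurable_sample k)
    (h.sample_law k) (h.indepFun (h.measurable_history.2.1 le_rfl))).2

/-- The three claims must be proved together: `z k` involves earlier stochastic gradients, and the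
next `x` involves the current one. -/
lemma memLp (h : IsDelayedSGD μ D g γ N a x z ξ) (hf : IsSmooth f L) (hL : 0 ≤ L)
    (hg : IsStochasticGradient f D g σ) (k : ℕ) :
    MemLp (x k) 2 μ ∧ MemLp (z k) 2 μ ∧ MemLp (fun ω => g (z k ω) (ξ k ω)) 2 μ := by
  induction k using Nat.strong_induction_on with
  | _ k ih =>
    have hx : MemLp (x k) 2 μ := by
      cases k with
      | zero => obtain ⟨x₀, hx₀⟩ := h.start; rw [hx₀]; exact memLp_const _
      | succ k =>
        obtain ⟨hx, -, hG⟩ := ih k k.lt_succ_self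
        rw [funext (h.step k)]
        exact hx.sub (hG.const_smul γ)
    have hz : MemLp (z k) 2 μ := by
      rw [funext (h.aux k)]
      exact hx.add (memLp_finsetSum _ fun i hi =>
        (ih i (Finset.mem_Ico.1 hi).2).2.2.const_smul (a k i))
    refine ⟨hx, hz, ?_⟩
    convert (h.memLp_noise hf hL hg k).add (hf.memLp_gradient hL hz) using 1
    ext1 ω
    simp

lemma integral_inner_noise (h : IsDelayedSGD μ D g γ N a x z ξ) (hf : IsSmooth f L) (hL : 0 ≤ L)
    (hg : IsStochasticGradient f D g σ) (k : ℕ) {v : Ω → Vec d}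
    (hv : Measurable[history x z ξ k] v) (hv' : MemLp v 2 μ) (hv'' : Measurable v) :
    ∫ ω, inner ℝ (v ω) (g (z k ω) (ξ k ω) - gradient f (z k ω)) ∂μ = 0 :=
  hg.integral_inner_noise hf hL (h.measurable_z k) hv'' (h.measurable_sample k) (h.sample_law k)
    (h.indepFun (Measurable.prodMk (h.measurable_history.2.1 le_rfl) hv))
    (integrable_inner_of_memLp hv' (h.memLp_noise hf hL hg k))

/-- The noise terms are martingale differences: each is orthogonal to the sum of its predecessors,
which the history determines. -/
lemma integral_sum_noise_sq_le (h : IsDelayedSGD μ D g γ N a x z ξ) (hf : IsSmooth f L)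
    (hL : 0 ≤ L) (hg : IsStochasticGradient f D g σ) (c : ℕ → ℝ) {l k : ℕ} (hlk : l ≤ k) :
    ∫ ω, ‖∑ i ∈ Finset.Ico l k, c i • (g (z i ω) (ξ i ω) - gradient f (z i ω))‖ ^ 2 ∂μ
      ≤ (∑ i ∈ Finset.Ico l k, c i ^ 2) * σ ^ 2 := by
  induction k, hlk using Nat.le_induction with
  | base => simp
  | succ k hlk ih =>
    set M : Ω → Vec d := fun ω =>
      ∑ i ∈ Finset.Ico l k, c i • (g (z i ω) (ξ i ω) - gradient f (z i ω))
    set n : Ω → Vec d := fun ω => g (z k ω) (ξ k ω) - gradient f (z k ω) with hn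
    have hnoise := hg.measurable_noise hf hL
    have hMhist : Measurable[history x z ξ k] M := by
      refine Finset.measurable_sum _ fun i hi => ?_
      have hi' := (Finset.mem_Ico.1 hi).2
      have h1 : Measurable[history x z ξ k] fun ω => (z i ω, ξ i ω) :=
        Measurable.prodMk (h.measurable_history.2.1 hi'.le) (h.measurable_history.2.2 hi')
      exact Measurable.const_smul (hnoise.comp h1) (c i)
    have hMmeas : Measurable M := Finset.measurable_sum _ fun i _ =>
      (hnoise.comp ((h.measurable_z i).prodMk (h.measurable_sample i))).const_smul (c i)
    have hMLp : MemLp M 2 μ := memLp_finsetSum _ fun i _ =>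
      (h.memLp_noise hf hL hg i).const_smul (c i)
    have hnLp : MemLp n 2 μ := h.memLp_noise hf hL hg k
    have horth : ∫ ω, inner ℝ (M ω) (n ω) ∂μ = 0 :=
      h.integral_inner_noise hf hL hg k hMhist hMLp hMmeas
    have hn2 : ∫ ω, ‖n ω‖ ^ 2 ∂μ ≤ σ ^ 2 := h.integral_noise_sq_le hf hL hg k
    have hexp : ∀ ω, ‖∑ i ∈ Finset.Ico l (k + 1), c i • (g (z i ω) (ξ i ω) - gradient f (z i ω))‖ ^ 2
        = ‖M ω‖ ^ 2 + 2 * c k * inner ℝ (M ω) (n ω) + c k ^ 2 * ‖n ω‖ ^ 2 := by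
      intro ω
      rw [Finset.sum_Ico_succ_top hlk, norm_add_sq_real, inner_smul_right, norm_smul, mul_pow,
        Real.norm_eq_abs, sq_abs, ← mul_assoc]
    have i1 := hMLp.integrable_norm_pow two_ne_zero
    have i2 := (integrable_inner_of_memLp hMLp hnLp).const_mul (2 * c k)
    have i3 := (hnLp.integrable_norm_pow two_ne_zero).const_mul (c k ^ 2)
    simp_rw [hexp]
    have i12 : Integrable (fun ω => ‖M ω‖ ^ 2 + 2 * c k * inner ℝ (M ω) (n ω)) μ := i1.add i2
    rw [integral_add i12 i3, integral_add i1 i2, integral_const_mul, integral_const_mul,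
      horth, Finset.sum_Ico_succ_top hlk]
    nlinarith [mul_le_mul_of_nonneg_left hn2 (sq_nonneg (c k))]

/-- The expected squared difference of the gradients at `x k` and `z k`. -/
lemma integral_gradient_sub_sq_le (h : IsDelayedSGD μ D g γ N a x z ξ) (hf : IsSmooth f L)
    (hL : 0 ≤ L) (hg : IsStochasticGradient f D g σ) {A : ℝ} {k : ℕ}
    (hA : ∑ i ∈ Finset.Ico (k - N) k, a k i ^ 2 ≤ A) :
    ∫ ω, ‖gradient f (x k ω) - gradient f (z k ω)‖ ^ 2 ∂μ ≤ 2 * L ^ 2 * A *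
      (∑ i ∈ Finset.Ico (k - N) k, ∫ ω, ‖gradient f (z i ω)‖ ^ 2 ∂μ + σ ^ 2) := by
  set T := Finset.Ico (k - N) k
  set M : Ω → Vec d := fun ω =>
    ∑ i ∈ T, a k i • (g (z i ω) (ξ i ω) - gradient f (z i ω))
  have hMLp : MemLp M 2 μ := memLp_finsetSum _ fun i _ =>
    (h.memLp_noise hf hL hg i).const_smul (a k i)
  have hM2 : ∫ ω, ‖M ω‖ ^ 2 ∂μ ≤ (∑ i ∈ T, a k i ^ 2) * σ ^ 2 :=
    h.integral_sum_noise_sq_le hf hL hg (a k) (Nat.sub_le k N)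
  have hgz : ∀ i, MemLp (fun ω => gradient f (z i ω)) 2 μ := fun i =>
    hf.memLp_gradient hL (h.memLp hf hL hg i).2.1
  have hgz2 : ∀ i, Integrable (fun ω => ‖gradient f (z i ω)‖ ^ 2) μ := fun i =>
    (hgz i).integrable_norm_pow two_ne_zero
  have hA0 : 0 ≤ ∑ i ∈ T, a k i ^ 2 := Finset.sum_nonneg fun i _ => sq_nonneg _
  have hpt : ∀ ω, ‖gradient f (x k ω) - gradient f (z k ω)‖ ^ 2 ≤
      2 * L ^ 2 * ((∑ i ∈ T, a k i ^ 2) * ∑ i ∈ T, ‖gradient f (z i ω)‖ ^ 2 + ‖M ω‖ ^ 2) := by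
    intro ω
    set P : Vec d := ∑ i ∈ T, a k i • gradient f (z i ω) with hP
    -- Splitting into true gradients `P` and noise `M ω`; only `P` needs Cauchy-Schwarz.
    have hdiff : z k ω - x k ω = P + M ω := by
      rw [h.aux, hP, ← Finset.sum_add_distrib, add_sub_cancel_left]
      exact Finset.sum_congr rfl fun i _ => by rw [← smul_add, add_sub_cancel]
    have hPsq : ‖P‖ ^ 2 ≤ (∑ i ∈ T, a k i ^ 2) * ∑ i ∈ T, ‖gradient f (z i ω)‖ ^ 2 := by
      have h1 : ‖P‖ ≤ ∑ i ∈ T, |a k i| * ‖gradient f (z i ω)‖ :=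
        (norm_sum_le _ _).trans_eq (Finset.sum_congr rfl fun i _ => by
          rw [norm_smul, Real.norm_eq_abs])
      have h2 := Finset.sum_mul_sq_le_sq_mul_sq T (fun i => |a k i|)
        (fun i => ‖gradient f (z i ω)‖)
      simp only [sq_abs] at h2
      exact (pow_le_pow_left₀ (norm_nonneg _) h1 2).trans h2
    have h1 : ‖gradient f (x k ω) - gradient f (z k ω)‖ ≤ L * ‖P + M ω‖ := by
      rw [← hdiff, norm_sub_rev (z k ω)]; exact hf.2 _ _
    have h2 := pow_le_pow_left₀ (norm_nonneg _) h1 2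
    have h3 : ‖P + M ω‖ ^ 2 ≤ 2 * (‖P‖ ^ 2 + ‖M ω‖ ^ 2) := by
      have := pow_le_pow_left₀ (norm_nonneg _) (norm_add_le P (M ω)) 2
      nlinarith [sq_nonneg (‖P‖ - ‖M ω‖)]
    calc _ ≤ (L * ‖P + M ω‖) ^ 2 := h2
      _ = L ^ 2 * ‖P + M ω‖ ^ 2 := mul_pow _ _ _
      _ ≤ L ^ 2 * (2 * (((∑ i ∈ T, a k i ^ 2) * ∑ i ∈ T, ‖gradient f (z i ω)‖ ^ 2)
          + ‖M ω‖ ^ 2)) := by gcongr; linarith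
      _ = _ := by ring
  have i1 : Integrable (fun ω => ∑ i ∈ T, ‖gradient f (z i ω)‖ ^ 2) μ :=
    integrable_finsetSum _ fun i _ => hgz2 i
  have i2 := hMLp.integrable_norm_pow two_ne_zero
  have hB : 0 ≤ ∑ i ∈ T, ∫ ω, ‖gradient f (z i ω)‖ ^ 2 ∂μ :=
    Finset.sum_nonneg fun i _ => integral_nonneg fun _ => sq_nonneg _
  calc _ ≤ ∫ ω, 2 * L ^ 2 * ((∑ i ∈ T, a k i ^ 2) * ∑ i ∈ T, ‖gradient f (z i ω)‖ ^ 2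
          + ‖M ω‖ ^ 2) ∂μ := integral_mono
        (((hf.memLp_gradient hL (h.memLp hf hL hg k).1).sub (hgz k)).integrable_norm_pow
          two_ne_zero) (((i1.const_mul _).add i2).const_mul _) hpt
    _ = 2 * L ^ 2 * ((∑ i ∈ T, a k i ^ 2) * ∑ i ∈ T, ∫ ω, ‖gradient f (z i ω)‖ ^ 2 ∂μ
          + ∫ ω, ‖M ω‖ ^ 2 ∂μ) := by
        rw [integral_const_mul, integral_add (i1.const_mul _) i2, integral_const_mul,
          integral_finsetSum _ fun i _ => hgz2 i]
    _ ≤ 2 * L ^ 2 * (A * ∑ i ∈ T, ∫ ω, ‖gradient f (z i ω)‖ ^ 2 ∂μ + A * σ ^ 2) := by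
        gcongr
        exact hM2.trans (by gcongr)
    _ = _ := by ring

/-- The expected decrease of `f` in one step. -/
lemma integral_step_le (h : IsDelayedSGD μ D g γ N a x z ξ) (hf : IsSmooth f L)
    (hf_bdd : BddBelow (Set.range f)) (hL : 0 ≤ L) (hg : IsStochasticGradient f D g σ) (k : ℕ) :
    ∫ ω, f (x (k + 1) ω) ∂μ ≤ ∫ ω, f (x k ω) ∂μ
      - γ / 2 * (∫ ω, ‖gradient f (x k ω)‖ ^ 2 ∂μ + ∫ ω, ‖gradient f (z k ω)‖ ^ 2 ∂μ
        - ∫ ω, ‖gradient f (x k ω) - gradient f (z k ω)‖ ^ 2 ∂μ)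
      + L / 2 * γ ^ 2 * (∫ ω, ‖gradient f (z k ω)‖ ^ 2 ∂μ + σ ^ 2) := by
  obtain ⟨hx, hz, -⟩ := h.memLp hf hL hg k
  have hgx := hf.memLp_gradient hL hx
  have hgz := hf.memLp_gradient hL hz
  have hn := h.memLp_noise hf hL hg k
  have hcont := (hf.lipschitzWith hL).continuous.measurable
  have ox := h.integral_inner_noise hf hL hg k (hcont.comp (h.measurable_history.1 le_rfl)) hgx
    (hcont.comp (h.measurable_x k))
  have oz := h.integral_inner_noise hf hL hg k (hcont.comp (h.measurable_history.2.1 le_rfl)) hgz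
    (hcont.comp (h.measurable_z k))
  have hσ := h.integral_noise_sq_le hf hL hg k
  have ix := integrable_inner_of_memLp hgx hn
  have iz := integrable_inner_of_memLp hgz hn
  simp only [Function.comp_apply] at ox oz
  have jx := hgx.integrable_norm_pow two_ne_zero
  have jz := hgz.integrable_norm_pow two_ne_zero
  have jn := hn.integrable_norm_pow two_ne_zero
  have jc := (hgx.sub hgz).integrable_norm_pow two_ne_zero
  have jf := hf.integrable_comp hf_bdd hx
  simp only [Pi.sub_apply] at jc
  have hpt : ∀ ω, f (x (k + 1) ω) ≤ f (x k ω)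
      + (-(γ / 2)) * ‖gradient f (x k ω)‖ ^ 2 + (L / 2 * γ ^ 2 - γ / 2) * ‖gradient f (z k ω)‖ ^ 2
      + γ / 2 * ‖gradient f (x k ω) - gradient f (z k ω)‖ ^ 2
      + (-γ) * inner ℝ (gradient f (x k ω)) (g (z k ω) (ξ k ω) - gradient f (z k ω))
      + L * γ ^ 2 * inner ℝ (gradient f (z k ω)) (g (z k ω) (ξ k ω) - gradient f (z k ω))
      + L / 2 * γ ^ 2 * ‖g (z k ω) (ξ k ω) - gradient f (z k ω)‖ ^ 2 := by
    intro ω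
    have h1 := hf.le_add_inner_add (x k ω) (-(γ • g (z k ω) (ξ k ω)))
    rw [← sub_eq_add_neg, ← h.step, norm_neg, norm_smul, mul_pow, Real.norm_eq_abs, sq_abs,
      inner_neg_right, inner_smul_right] at h1
    set u := gradient f (x k ω)
    set w := gradient f (z k ω)
    set n := g (z k ω) (ξ k ω) - w with hn
    have hG : g (z k ω) (ξ k ω) = w + n := by rw [hn, add_sub_cancel]
    rw [hG, inner_add_right, norm_add_sq_real] at h1
    -- Polarization turns `-γ⟪u, w⟫` into the three squared norms of the bound.
    have h2 := norm_sub_sq_real u w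
    refine h1.trans_eq ?_
    rw [h2]
    ring
  have J1 := jf.add (jx.const_mul (-(γ / 2)))
  have J2 := J1.add (jz.const_mul (L / 2 * γ ^ 2 - γ / 2))
  have J3 := J2.add (jc.const_mul (γ / 2))
  have J4 := J3.add (ix.const_mul (-γ))
  have J5 := J4.add (iz.const_mul (L * γ ^ 2))
  have J6 := J5.add (jn.const_mul (L / 2 * γ ^ 2))
  have hint := integral_mono (hf.integrable_comp hf_bdd (h.memLp hf hL hg (k + 1)).1) J6 hpt
  rw [integral_add' J5 (jn.const_mul _), integral_add' J4 (iz.const_mul _),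
    integral_add' J3 (ix.const_mul _), integral_add' J2 (jc.const_mul _),
    integral_add' J1 (jz.const_mul _), integral_add' jf (jx.const_mul _)] at hint
  simp only [integral_const_mul, ox, oz] at hint
  have := mul_le_mul_of_nonneg_left hσ (by positivity : 0 ≤ L / 2 * γ ^ 2)
  linarith

end IsDelayedSGD

/-- Each index lies in at most `N` of the windows. -/
lemma sum_sum_Ico_sub_le {B : ℕ → ℝ} (hB : ∀ i, 0 ≤ B i) (N K : ℕ) :
    ∑ k ∈ Finset.range K, ∑ i ∈ Finset.Ico (k - N) k, B i ≤ N * ∑ i ∈ Finset.range K, B i := by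
  rw [Finset.sum_comm' (t' := Finset.range K) (s' := fun i => Finset.Ico (i + 1) (min (i + N + 1) K))
    (by intro k i; simp only [Finset.mem_range, Finset.mem_Ico]; omega), Finset.mul_sum]
  refine Finset.sum_le_sum fun i _ => ?_
  rw [Finset.sum_const, Nat.card_Ico, nsmul_eq_mul]
  refine mul_le_mul_of_nonneg_right ?_ (hB i)
  exact_mod_cast (by omega : min (i + N + 1) K - (i + 1) ≤ N)

/-! ### The global step size -/

section StepSize

lemma toReal_mul_le_of_le_div {t : ENNReal} {c q : ℝ} (hc : 0 < c) (hq : 0 ≤ q)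
    (h : t ≤ ENNReal.ofReal c / ENNReal.ofReal q) : t.toReal * q ≤ c := by
  have h1 := ENNReal.toReal_mono ENNReal.ofReal_ne_top (ENNReal.mul_le_of_le_div h)
  rwa [ENNReal.toReal_mul, ENNReal.toReal_ofReal hq, ENNReal.toReal_ofReal hc.le] at h1

/-- Finiteness of `t` excludes `q = 0`, where the quotient is `⊤`. -/
lemma toReal_mul_eq_of_eq_div {t : ENNReal} {c q : ℝ} (ht : t ≠ ⊤) (hc : 0 < c) (hq : 0 ≤ q)
    (h : t = ENNReal.ofReal c / ENNReal.ofReal q) : t.toReal * q = c := by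
  have hq0 : ENNReal.ofReal q ≠ 0 := by
    intro h0
    rw [h0, ENNReal.div_zero (ENNReal.ofReal_pos.2 hc).ne'] at h
    exact ht h
  have h1 := congrArg ENNReal.toReal
    (h ▸ ENNReal.div_mul_cancel hq0 ENNReal.ofReal_ne_top : t * ENNReal.ofReal q = _)
  rwa [ENNReal.toReal_mul, ENNReal.toReal_ofReal hq, ENNReal.toReal_ofReal hc.le] at h1

/-- The multiplied form stays valid for zero denominators. The final disjunction, that the minimum
is attained, keeps the step from being too small. -/
lemma globalStepSize_spec {L R σ ε : ℝ} (hL : 0 < L) (hε : 0 < ε) (hR : 0 ≤ R) :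
    0 < globalStepSize L R σ ε ∧ globalStepSize L R σ ε * (2 * L) ≤ 1 ∧
      globalStepSize L R σ ε * (4 * R * L) ≤ 1 ∧ globalStepSize L R σ ε * (8 * σ ^ 2 * L) ≤ ε ∧
      (globalStepSize L R σ ε * (2 * L) = 1 ∨ globalStepSize L R σ ε * (4 * R * L) = 1 ∨
        globalStepSize L R σ ε * (8 * σ ^ 2 * L) = ε) := by
  have h1 : (0 : ℝ) ≤ 2 * L := by positivity
  have h2 : (0 : ℝ) ≤ 4 * R * L := by positivity
  have h3 : (0 : ℝ) ≤ 8 * σ ^ 2 * L := by positivity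
  rw [globalStepSize, ← ENNReal.ofReal_one]
  set t₁ := ENNReal.ofReal 1 / ENNReal.ofReal (2 * L) with ht₁
  set t₂ := ENNReal.ofReal 1 / ENNReal.ofReal (4 * R * L) with ht₂
  set t₃ := ENNReal.ofReal ε / ENNReal.ofReal (8 * σ ^ 2 * L) with ht₃
  have hpos : ∀ {c q : ℝ}, 0 < c → 0 < ENNReal.ofReal c / ENNReal.ofReal q := fun hc =>
    ENNReal.div_pos (ENNReal.ofReal_pos.2 hc).ne' ENNReal.ofReal_ne_top
  have htop : min t₁ (min t₂ t₃) ≠ ⊤ := ne_top_of_le_ne_top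
    (ENNReal.div_ne_top ENNReal.ofReal_ne_top (ENNReal.ofReal_pos.2 (by positivity)).ne')
    (min_le_left _ _)
  refine ⟨ENNReal.toReal_pos ?_ htop,
    toReal_mul_le_of_le_div one_pos h1 (min_le_left _ _),
    toReal_mul_le_of_le_div one_pos h2 ((min_le_right _ _).trans (min_le_left _ _)),
    toReal_mul_le_of_le_div hε h3 ((min_le_right _ _).trans (min_le_right _ _)), ?_⟩
  · exact (lt_min (hpos one_pos) (lt_min (hpos one_pos) (hpos hε))).ne'
  · rcases min_choice t₁ (min t₂ t₃) with h | h
    · exact Or.inl (toReal_mul_eq_of_eq_div htop one_pos h1 h)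
    · rcases min_choice t₂ t₃ with h' | h'
      · exact Or.inr (Or.inl (toReal_mul_eq_of_eq_div htop one_pos h2 (h.trans h')))
      · exact Or.inr (Or.inr (toReal_mul_eq_of_eq_div htop hε h3 (h.trans h')))

end StepSize

/-! ### Solving the inequalities and assembling the proof -/

/-- The inequalities between the sums of the squared gradient norms at `x k` (here `X`) and at
`z k` (here `Y`) bound `X`. -/
lemma le_of_descent_bounds {u v w E P X Y C : ℝ} (hu : 0 ≤ u) (hv : 0 ≤ v) (hw : 0 ≤ w)
    (hE : 0 ≤ E) (hP : 0 ≤ P) (hY : 0 ≤ Y)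
    (hu2 : u ≤ 1 / 2) (hv4 : v ≤ 1 / 4) (hw8 : w ≤ 1 / 8)
    (hor : u = 1 / 2 ∨ v = 1 / 4 ∨ w = 1 / 8)
    (hdesc : X + Y - C - u * Y - w * E ≤ P)
    (hC : C ≤ 4 * v ^ 2 * Y + 4 * v * w * E)
    (hXY : X ≤ 2 * Y + 2 * C)
    (hPE : P * (4 * v + 4 * u + 8 * w) ≤ E)
    (hcase : (C = 0 ∧ X = Y) ∨ u ≤ v) : X ≤ E := by
  have hwE : w * E ≤ 1 / 8 * E := by gcongr
  rcases hcase with ⟨rfl, rfl⟩ | huv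
  · have hPE' : P ≤ E := by
      refine le_trans ?_ hPE
      nlinarith [show 1 ≤ 4 * v + 4 * u + 8 * w by rcases hor with h | h | h <;> linarith]
    nlinarith
  · have hvY : 4 * v ^ 2 * Y ≤ 1 / 4 * Y := by gcongr; nlinarith
    have huY : u * Y ≤ 1 / 4 * Y := by gcongr; linarith
    have hPu : 0 ≤ P * u := by positivity
    rcases hor with h | rfl | rfl
    -- Impossible: `u = 1/2` contradicts `u ≤ v ≤ 1/4`.
    · linarith
    · have hX : X ≤ P + 2 * (w * E) := by linarith
      -- Here `P * (1 + 8w) ≤ E`, and `(1 + 8w)(1 - 2w) ≥ 1` since `w ≤ 1/8`.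
      have hle : P ≤ E * (1 - 2 * w) := by
        refine le_of_mul_le_mul_right (a := 1 + 8 * w) ?_ (by linarith)
        have : 0 ≤ E * (w * (6 - 16 * w)) := by
          have : 0 ≤ 6 - 16 * w := by linarith
          positivity
        nlinarith
      linarith
    -- Dropping `Y` loses too much as `v` tends to `0`; for `v ≤ 1/16` the positive `Y` term is kept
    -- and bounded below through `hXY`.
    · rcases le_total (1 / 16) v with h16 | h16
      · have hX : X ≤ P + E / 8 + v * E / 2 := by linarith
        have hle : P ≤ E * (7 / 8 - v / 2) := by
          refine le_of_mul_le_mul_right (a := 1 + 4 * v) ?_ (by linarith)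
          have : 0 ≤ E * (3 * v - 2 * v ^ 2 - 1 / 8) :=
            mul_nonneg hE (by nlinarith)
          nlinarith
        linarith
      · have hvY' : 4 * v ^ 2 * Y ≤ 1 / 64 * Y := by gcongr; nlinarith
        have huY' : u * Y ≤ 1 / 16 * Y := by gcongr; linarith
        have hvE : v * E ≤ 1 / 16 * E := by gcongr
        have hPv : 0 ≤ P * v := by positivity
        linarith

variable {d : ℕ} {Ω S : Type*} [MeasurableSpace Ω] [MeasurableSpace S]
  {μ : Measure Ω} {D : Measure S} {f : Vec d → ℝ} {g : Vec d → S → Vec d} {L σ ε R : ℝ}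

/-- The points of a main branch are iterates of SGD with delayed gradients. -/
lemma ComputationTree.IsMainBranch.exists_isDelayedSGD {γ : ℝ} {G : ComputationTree d μ D}
    {b : ℕ → ℕ} (hb : G.IsMainBranch b) (hR : 0 ≤ R) (hγ : 0 ≤ γ)
    (hg : IsStochasticGradient f D g σ)
    (h_indep : ∀ k : ℕ, IndepFun (G.auxSample b k)
      (fun ω (i : Fin k) => (G.point g (b (i + 1)) ω, G.point g (G.auxNode b (i + 1)) ω,
        G.auxSample b i ω)) μ)
    (h_repr : ∀ k : ℕ, G.representation g (G.auxNode b k) ≤ G.representation g (b k))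
    (h_dist : ∀ k : ℕ, (G.treeDist (b k) (G.auxNode b k) : ℝ) ≤ R)
    (h_main : ∀ k : ℕ, G.auxStepSize b k = γ)
    (h_off : ∀ s : ℕ, (∀ k : ℕ, b (k + 1) ≠ s + 1) →
      G.stepSize s ≤
        √(R / (((G.distToBranch b (G.base s) : ℝ) + 1) * (Real.log R + 1))) * γ) :
    ∃ a : ℕ → ℕ → ℝ, IsDelayedSGD μ D g γ ⌊R⌋₊ a (fun k => G.point g (b k))
        (fun k => G.point g (G.auxNode b k)) (fun k => G.auxSample b k) ∧
      ∀ k, ∑ i ∈ Finset.Ico (k - ⌊R⌋₊) k, a k i ^ 2 ≤ 2 * R * γ ^ 2 := by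
  choose a ha ha' using fun k => hb.exists_coefficients g hR hγ (h_repr k) (h_dist k) h_main h_off
  refine ⟨a, ⟨⟨G.start, ?_⟩, fun k ω => ?_, ha, fun k => G.sample_measurable _,
    fun k => G.sample_law _, fun k => G.measurable_point hg.measurable _,
    fun k => G.measurable_point hg.measurable _, h_indep⟩, ha'⟩
  · rw [hb.1, point]
  · rw [hb.point_succ, h_main]

variable [IsProbabilityMeasure μ] [IsProbabilityMeasure D]

/-- Combines the telescoped descent with the summed drift bound; `hK` makes the initial gap `Δ`
small enough against `K * ε`. -/
lemma IsDelayedSGD.sum_integral_gradient_sq_le {a : ℕ → ℕ → ℝ} {x z : ℕ → Ω → Vec d}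
    {ξ : ℕ → Ω → S} {x₀ : Vec d}
    (h : IsDelayedSGD μ D g (globalStepSize L R σ ε) ⌊R⌋₊ a x z ξ) (hx₀ : x 0 = fun _ => x₀)
    (hL : 0 < L) (hε : 0 < ε) (hR : 0 ≤ R) (hf : IsSmooth f L)
    (hf_bdd : BddBelow (Set.range f)) (hg : IsStochasticGradient f D g σ)
    (ha : ∀ k, ∑ i ∈ Finset.Ico (k - ⌊R⌋₊) k, a k i ^ 2 ≤ 2 * R * globalStepSize L R σ ε ^ 2)
    {K : ℕ} (hK : 8 * (R + 1) * L * (f x₀ - ⨅ y, f y) / ε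
      + 16 * σ ^ 2 * L * (f x₀ - ⨅ y, f y) / ε ^ 2 ≤ (K : ℝ)) :
    ∑ k ∈ Finset.range K, ∫ ω, ‖gradient f (x k ω)‖ ^ 2 ∂μ ≤ K * ε := by
  obtain ⟨hγ, hγ1, hγ2, hγ3, hor⟩ := globalStepSize_spec (σ := σ) hL hε hR
  set γ := globalStepSize L R σ ε
  set Δ := f x₀ - ⨅ y, f y with hΔ
  have hΔ0 : 0 ≤ Δ := sub_nonneg.2 (ciInf_le hf_bdd x₀)
  set A : ℕ → ℝ := fun k => ∫ ω, ‖gradient f (x k ω)‖ ^ 2 ∂μ with hA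
  set B : ℕ → ℝ := fun k => ∫ ω, ‖gradient f (z k ω)‖ ^ 2 ∂μ with hB
  set C : ℕ → ℝ := fun k => ∫ ω, ‖gradient f (x k ω) - gradient f (z k ω)‖ ^ 2 ∂μ with hC
  have hB0 : ∀ k, 0 ≤ B k := fun k => integral_nonneg fun _ => sq_nonneg _
  have hmem := h.memLp hf hL.le hg
  have hgx : ∀ k, MemLp (fun ω => gradient f (x k ω)) 2 μ := fun k =>
    hf.memLp_gradient hL.le (hmem k).1
  have hgz : ∀ k, MemLp (fun ω => gradient f (z k ω)) 2 μ := fun k =>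
    hf.memLp_gradient hL.le (hmem k).2.1
  have hABC : ∀ k, A k ≤ 2 * B k + 2 * C k := by
    intro k
    have i1 := ((hgz k).integrable_norm_pow two_ne_zero).const_mul 2
    have i2 := (((hgx k).sub (hgz k)).integrable_norm_pow two_ne_zero).const_mul 2
    simp only [Pi.sub_apply] at i2
    have := integral_mono ((hgx k).integrable_norm_pow two_ne_zero) (i1.add i2) fun ω => by
      have h1 := norm_add_le (gradient f (z k ω)) (gradient f (x k ω) - gradient f (z k ω))
      rw [add_sub_cancel] at h1
      have h2 := pow_le_pow_left₀ (norm_nonneg _) h1 2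
      simp only [Pi.add_apply]
      nlinarith [sq_nonneg (‖gradient f (z k ω)‖ - ‖gradient f (x k ω) - gradient f (z k ω)‖)]
    rwa [integral_add' i1 i2, integral_const_mul, integral_const_mul] at this
  -- One factor `R` comes from the coefficient bound, the other from the window length `⌊R⌋₊`; the
  -- noise term carries only the first.
  have hCsum : ∑ k ∈ Finset.range K, C k ≤ 4 * (R * (L * γ)) ^ 2 * ∑ k ∈ Finset.range K, B k
      + 4 * L ^ 2 * R * γ ^ 2 * (K * σ ^ 2) := by
    calc _ ≤ ∑ k ∈ Finset.range K, 2 * L ^ 2 * (2 * R * γ ^ 2) *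
            (∑ i ∈ Finset.Ico (k - ⌊R⌋₊) k, B i + σ ^ 2) :=
          Finset.sum_le_sum fun k _ => h.integral_gradient_sub_sq_le hf hL.le hg (ha k)
      _ = 2 * L ^ 2 * (2 * R * γ ^ 2) *
            (∑ k ∈ Finset.range K, ∑ i ∈ Finset.Ico (k - ⌊R⌋₊) k, B i + K * σ ^ 2) := by
          rw [← Finset.mul_sum, Finset.sum_add_distrib]; simp
      _ ≤ 2 * L ^ 2 * (2 * R * γ ^ 2) * (R * ∑ k ∈ Finset.range K, B k + K * σ ^ 2) := by
          gcongr
          exact (sum_sum_Ico_sub_le hB0 _ _).trans (mul_le_mul_of_nonneg_right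
            (Nat.floor_le hR) (Finset.sum_nonneg fun i _ => hB0 i))
      _ = _ := by ring
  have htel : ∀ n, ∫ ω, f (x n ω) ∂μ ≤ f x₀
      - γ / 2 * (∑ k ∈ Finset.range n, A k + ∑ k ∈ Finset.range n, B k
        - ∑ k ∈ Finset.range n, C k)
      + L / 2 * γ ^ 2 * (∑ k ∈ Finset.range n, B k + n * σ ^ 2) := by
    intro n
    induction n with
    | zero => simp [hx₀]
    | succ n ih =>
      have hs : _ ≤ ∫ ω, f (x n ω) ∂μ - γ / 2 * (A n + B n - C n) + L / 2 * γ ^ 2 * (B n + σ ^ 2) :=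
        h.integral_step_le hf hf_bdd hL.le hg n
      simp only [Finset.sum_range_succ]
      push_cast
      linarith
  have hinf : ⨅ y, f y ≤ ∫ ω, f (x K ω) ∂μ := by
    have := integral_mono (integrable_const (μ := μ) (⨅ y, f y))
      (hf.integrable_comp hf_bdd (hmem K).1) fun ω => ciInf_le hf_bdd _
    simpa using this
  have hmain := hinf.trans (htel K)
  set X := ∑ k ∈ Finset.range K, A k with hX
  set Y := ∑ k ∈ Finset.range K, B k with hY
  set Z := ∑ k ∈ Finset.range K, C k with hZ
  -- Dimensionless form: the three bounds on `γ` become `u ≤ 1/2`, `v ≤ 1/4`, `w ≤ 1/8`, with `E = K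
  -- * ε`.
  refine le_of_descent_bounds (u := L * γ) (v := R * (L * γ)) (w := σ ^ 2 * (L * γ) / ε)
    (P := 2 * Δ / γ) (Y := Y) (C := Z) (by positivity) (by positivity) (by positivity)
    (by positivity) (by positivity) (Finset.sum_nonneg fun i _ => hB0 i) (by linarith)
    (by linarith) ?_ ?_ ?_ ?_ ?_ ?_ ?_
  · rw [div_le_iff₀ hε]; linarith
  · rcases hor with h | h | h
    · left; linarith
    · right; left; linarith
    · right; right; rw [div_eq_iff hε.ne']; linarith
  · rw [le_div_iff₀ hγ]
    have : σ ^ 2 * (L * γ) / ε * (K * ε) = L * γ * (K * σ ^ 2) := by field_simp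
    rw [this]
    linarith
  · refine hCsum.trans_eq ?_
    field_simp
  · rw [hX, hY, hZ, Finset.mul_sum, Finset.mul_sum, ← Finset.sum_add_distrib]
    exact Finset.sum_le_sum fun k _ => hABC k
  · have h1 := mul_le_mul_of_nonneg_right hK hε.le
    refine le_trans (le_of_eq ?_) h1
    field_simp
    ring
  -- For `R < 1` the windows are empty and `z = x`; otherwise `L * γ ≤ R * (L * γ)`.
  · rcases lt_or_ge R 1 with h1 | h1
    · left
      have hzx : ∀ k, z k = x k := fun k => by
        ext1 ω
        rw [h.aux, Nat.floor_eq_zero.2 h1]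
        simp
      have hAB : A = B := by rw [hA, hB]; simp only [hzx]
      have hC0 : C = 0 := by ext k; simp [hC, hzx]
      exact ⟨by rw [hZ, hC0]; simp, by rw [hX, hY, hAB]⟩
    · right
      exact le_mul_of_one_le_left (by positivity) h1

end BirchSGD

theorem mainTheorem5 {d : ℕ} {Ω S : Type*} [MeasurableSpace Ω] [MeasurableSpace S]
    (μ : Measure Ω) [IsProbabilityMeasure μ] (D : Measure S) [IsProbabilityMeasure D]
    (f : BirchSGD.Vec d → ℝ) (g : BirchSGD.Vec d → S → BirchSGD.Vec d) (L σ ε R : ℝ)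
    (hL : 0 < L) (hε : 0 < ε) (hR : 0 ≤ R)
    (hf : BirchSGD.IsSmooth f L) (hf_bdd : BddBelow (Set.range f))
    (hg : BirchSGD.IsStochasticGradient f D g σ)
    (G : BirchSGD.ComputationTree d μ D) (b : ℕ → ℕ) (hb : G.IsMainBranch b)
    -- Condition 1: `ξ^k` is independent of `((x^{i+1}, z^{i+1}, ξ^i))_{i < k}`
    (h_indep : ∀ k : ℕ, IndepFun (G.auxSample b k)
      (fun ω (i : Fin k) => (G.point g (b (i + 1)) ω, G.point g (G.auxNode b (i + 1)) ω,
        G.auxSample b i ω)) μ)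
    -- Condition 2: `repr(z^k) ⊆ repr(x^k)` as multisets
    (h_repr : ∀ k : ℕ, G.representation g (G.auxNode b k) ≤ G.representation g (b k))
    -- Condition 3: `dist(x^k, z^k) ≤ R`
    (h_dist : ∀ k : ℕ, (G.treeDist (b k) (G.auxNode b k) : ℝ) ≤ R)
    -- Condition 4: the step sizes on and off the main branch
    (h_main : ∀ k : ℕ, G.auxStepSize b k = BirchSGD.globalStepSize L R σ ε)
    (h_off : ∀ s : ℕ, (∀ k : ℕ, b (k + 1) ≠ s + 1) →
      G.stepSize s ≤
        √(R / (((G.distToBranch b (G.base s) : ℝ) + 1) * (Real.log R + 1))) *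
          BirchSGD.globalStepSize L R σ ε) :
    (∀ k : ℕ, Integrable (fun ω => ‖gradient f (G.point g (b k) ω)‖ ^ 2) μ) ∧
    ∀ K : ℕ, 0 < K →
      8 * (R + 1) * L * (f G.start - ⨅ x, f x) / ε
        + 16 * σ ^ 2 * L * (f G.start - ⨅ x, f x) / ε ^ 2 ≤ (K : ℝ) →
      (1 / (K : ℝ)) * ∑ k ∈ Finset.range K, ∫ ω, ‖gradient f (G.point g (b k) ω)‖ ^ 2 ∂μ ≤ ε := by
  have hγ := (BirchSGD.globalStepSize_spec (σ := σ) hL hε hR).1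
  obtain ⟨a, h, ha⟩ := hb.exists_isDelayedSGD hR hγ.le hg h_indep h_repr h_dist h_main h_off
  refine ⟨fun k => (hf.memLp_gradient hL.le (h.memLp hf hL.le hg k).1).integrable_norm_pow
    two_ne_zero, fun K hK hKle => ?_⟩
  have hx₀ : G.point g (b 0) = fun _ => G.start := by rw [hb.1, BirchSGD.ComputationTree.point]
  have hsum := h.sum_integral_gradient_sq_le hx₀ hL hε hR hf hf_bdd hg ha hKle
  have hK' : (0 : ℝ) < K := by exact_mod_cast hK
  rw [one_div, inv_mul_le_iff₀ hK']
  exact hsum
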